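/- Let $F$ be a totally real number field with absolute Galois group $G_F=\mathrm{Gal}(\overline F/F)$, let $p$ be a prime number, let $\mathfrak l$ be a prime ideal of $\mathcal O_F$ not dividing $p$, and let $K/\mathbb Q_p$ be a finite extension. Write $K$ for the trivial one-dimensional $K$-representation of $G_F$ and $K(-1)$ for the one given by the inverse of the $p$-adic cyclotomic character. Let $$0\to K\to V\to K(-1)\to 0$$ be an extension of continuous $K$-representations of $G_F$. Say that $V$ is unramified at a finite place $v\nmid p$ of $F$ if the inertia groups at $v$ act trivially on $V$; say that it is unramified at a place $v\mid p$ or $v\mid\infty$ if the extension is split after restriction to the decomposition groups at $v$. If $V$ is unramified at every finite place $v\neq\mathfrak l$ of $F$ (in particular locally split at all places dividing $p$), then $V$ is unramified at every place of $F$, including $\mathfrak l$. In particular this holds for the non-split extension $V(x_L)$, with these properties, that is attached via Ribet's method to a reducible point $x_L$ (with semisimple Galois representation $\mathbf 1\oplus\chi_{\mathrm{cyc}}^{-1}$) of an eigenvariety over $F$ if Leopoldt's conjecture fails for $(F,p)$. -/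

import Mathlib

open scoped NumberField

noncomputable section

namespace GaloisExt

/-- The algebraic closure of `F` used below. -/
abbrev Fbar (F : Type*) [Field F] : Type _ := AlgebraicClosure F

/-- The absolute Galois group `G_F = Gal(F̄/F)`, with its Krull topology. -/
abbrev GF (F : Type*) [Field F] : Type _ := Gal(Fbar F/F)

/-- The `p`-adic cyclotomic character `χ : G_F → ℤ_pˣ`, determined by `g ζ = ζ ^ χ(g)` for
every root of unity `ζ` of `p`-power order. -/
def cyc (F : Type*) [Field F] (p : ℕ) [Fact p.Prime] : GF F →* ℤ_[p]ˣ :=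
  (cyclotomicCharacter (Fbar F) p).comp (MulSemiringAction.toRingAut (GF F) (Fbar F))

/-- The inverse cyclotomic character, with values in a field `K` containing `ℚ_p`: the scalar
by which `g` acts on `K(-1)`. -/
def cycInv (F : Type*) [Field F] (p : ℕ) [Fact p.Prime] (K : Type*) [Field K] [Algebra ℚ_[p] K]
    (g : GF F) : K :=
  algebraMap ℚ_[p] K (((cyc F p g)⁻¹ : ℤ_[p]ˣ) : ℤ_[p])

/-- An extension `0 → K → V → K(-1) → 0` of continuous representations of `G_F` over `K`, where
`K` carries the trivial action and `K(-1)` the action by the inverse cyclotomic character. -/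
structure TateExt (F : Type*) [Field F] (p : ℕ) [Fact p.Prime]
    (K : Type*) [NormedField K] [NormedAlgebra ℚ_[p] K]
    (V : Type*) [AddCommGroup V] [Module K V] [TopologicalSpace V] where
  /-- the action of `G_F` on `V` -/
  ρ : Representation K (GF F) V
  continuous_action : Continuous fun x : GF F × V => ρ x.1 x.2
  /-- the inclusion `K → V` -/
  incl : K →ₗ[K] V
  /-- the projection `V → K(-1)` -/
  proj : V →ₗ[K] K
  incl_injective : Function.Injective incl
  exact : Function.Exact incl proj
  proj_surjective : Function.Surjective proj
  incl_equivariant : ∀ (g : GF F) (a : K), ρ g (incl a) = incl a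
  proj_equivariant : ∀ (g : GF F) (x : V), proj (ρ g x) = cycInv F p K g * proj x

namespace TateExt

variable {F : Type*} [Field F] {p : ℕ} [Fact p.Prime]
  {K : Type*} [NormedField K] [NormedAlgebra ℚ_[p] K]
  {V : Type*} [AddCommGroup V] [Module K V] [TopologicalSpace V]

/-- The extension splits after restriction to the subgroup `H` of `G_F`: the projection
`V → K(-1)` has an `H`-equivariant `K`-linear section. -/
def SplitsOver (E : TateExt F p K V) (H : Subgroup (GF F)) : Prop :=
  ∃ s : K →ₗ[K] V, (∀ a, E.proj (s a) = a) ∧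
    ∀ g ∈ H, ∀ a, E.ρ g (s a) = s (cycInv F p K g * a)

open scoped Pointwise in
/-- The extension is unramified at the finite place `v` of `F`.

If `v ∤ p` this means that the inertia groups at `v` act trivially on `V`. If `v ∣ p`, where the
quotient `K(-1)` itself is a ramified representation, it means that the extension is locally
split at `v`, that is, split as an extension of representations of the decomposition groups.

The decomposition and inertia groups at `v` are those of the primes `P` of the ring of all
algebraic integers of `F̄` above `v`; the decomposition group of `P` is its stabilizer in `G_F`. -/
def IsUnramifiedAt (E : TateExt F p K V) (v : IsDedekindDomain.HeightOneSpectrum (𝓞 F)) : Prop :=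
  ∀ P : Ideal (𝓞 (Fbar F)), P.IsPrime → P.comap (algebraMap (𝓞 F) (𝓞 (Fbar F))) = v.asIdeal →
    ((p : 𝓞 F) ∉ v.asIdeal → ∀ g ∈ P.inertia (GF F), ∀ x : V, E.ρ g x = x) ∧
    ((p : 𝓞 F) ∈ v.asIdeal →
      E.SplitsOver (MulAction.stabilizer (GF F) P))

/-- The extension is unramified at every finite place of `F` other than `l`. -/
def IsUnramifiedOutside (E : TateExt F p K V)
    (l : IsDedekindDomain.HeightOneSpectrum (𝓞 F)) : Prop :=
  ∀ v : IsDedekindDomain.HeightOneSpectrum (𝓞 F), v ≠ l → E.IsUnramifiedAt v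

/-- The extension is unramified at every place of `F`: at every finite place, and, at the infinite
places, it is split over the decomposition groups (which are the groups generated by the complex
conjugations). -/
def IsUnramifiedEverywhere (E : TateExt F p K V) : Prop :=
  (∀ v : IsDedekindDomain.HeightOneSpectrum (𝓞 F), E.IsUnramifiedAt v) ∧
    ∀ w : NumberField.InfinitePlace (Fbar F), E.SplitsOver (MulAction.stabilizer (GF F) w)

end TateExt

end GaloisExt

end

/-! After a choice of basis, `V` is a cocycle `c`. A `ℚ_p`-linear functional on `K`, a twist by the
cyclotomic character and a power of `p` turn it into a continuous cocycle `b : G_F → ℤ_p(1)`. By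
Hilbert 90, `b` mod `p ^ n` is the Kummer cocycle of some nonzero `x ∈ 𝓞 F`. Away from `l` and `p`,
unramifiedness forces `p ^ n ∣ v(x)`; above `p`, local splitting makes `x` a local `p ^ n`-th power.

The norm to `ℚ` now bounds the ramification at `l`. With `Q = N(l)` and `k = v_l(x)`, one has
`|N(x)| = Q ^ k * Y ^ (p ^ n) * p ^ s`, while `N(x) ^ d` is a `p ^ n`-th power in `ℚ_p` for a `d`
depending only on `F` and `p`. Hence `Q ^ (2dk)` is a `p ^ n`-th power in `ℤ_pˣ`. As `Q > 1` is not
a root of unity, lifting the exponent gives `p ^ n ∣ D * k` with `D ≠ 0` independent of `n`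
(`exists_uniform_dvd`). So `D * b` vanishes mod `p ^ n` on inertia at `l` for every `n`, hence `b =
0` there (`cocycle_eq_zero_of_mem_inertia`), and letting the functional vary gives `c = 0`.

At infinite places the decomposition groups are finite, and averaging in characteristic zero splits
the extension. -/

noncomputable section
namespace GaloisExt
open scoped Pointwise

/-! ### Inertia in `F̄` versus finite layers, and valuations of radicals. -/

section Inertia

variable {F : Type*} [Field F]

theorem coe_smul_integer (g : GF F) (z : 𝓞 (Fbar F)) :
    ((g • z : 𝓞 (Fbar F)) : Fbar F) = g z := rfl

variable (M : IntermediateField F (Fbar F))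

instance isInvariant_integers [CharZero F] :
    Algebra.IsInvariant (𝓞 M) (𝓞 (Fbar F)) Gal(Fbar F/M) where
  isInvariant z hz := by
    have hz' : ∀ g : Gal(Fbar F/M), g (z : Fbar F) = z := fun g =>
      congrArg (algebraMap (𝓞 (Fbar F)) (Fbar F)) (hz g)
    obtain ⟨y, hy⟩ := (InfiniteGalois.mem_bot_iff_fixed (k := M) (z : Fbar F)).mpr hz'
    have hy' : algebraMap M (Fbar F) y = z := hy
    have hi : IsIntegral ℤ y := by
      rw [← isIntegral_algebraMap_iff (algebraMap M (Fbar F)).injective, hy']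
      exact z.isIntegral_coe
    exact ⟨⟨y, hi⟩, NumberField.RingOfIntegers.ext hy'⟩

instance smulCommClass_integers :
    SMulCommClass Gal(Fbar F/M) (𝓞 M) (𝓞 (Fbar F)) where
  smul_comm g a z := by
    ext
    change g ((algebraMap M (Fbar F) (a : M)) * (z : Fbar F)) =
      (algebraMap M (Fbar F) (a : M)) * g (z : Fbar F)
    rw [map_mul, g.commutes]

theorem continuousSMul_integers [TopologicalSpace (𝓞 (Fbar F))] [DiscreteTopology (𝓞 (Fbar F))] :
    ContinuousSMul Gal(Fbar F/M) (𝓞 (Fbar F)) := by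
  rw [continuousSMul_iff_stabilizer_isOpen]
  intro z
  have h : IsOpen ((MulAction.stabilizer Gal(Fbar F/M) (z : Fbar F) :
      Subgroup Gal(Fbar F/M)) : Set Gal(Fbar F/M)) := stabilizer_isOpen_of_isIntegral (z : Fbar F)
  convert h using 2
  ext g
  exact ⟨fun h => congrArg (algebraMap (𝓞 (Fbar F)) (Fbar F)) h,
    fun h => NumberField.RingOfIntegers.ext h⟩

/-- Elements of the inertia group of a finite normal layer lift to the absolute inertia group. -/
theorem exists_mem_inertia_restrictNormalHom_eq [CharZero F] [Normal F M] (P : Ideal (𝓞 (Fbar F)))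
    [P.IsPrime] (g : Gal(M/F))
    (hg : g ∈ (P.under (𝓞 M)).inertia Gal(M/F)) :
    ∃ k ∈ P.inertia (GF F), AlgEquiv.restrictNormalHom M k = g := by
  obtain ⟨g', rfl⟩ := AlgEquiv.restrictNormalHom_surjective (F := F) (K₁ := M) (Fbar F) g
  have key (k : GF F) (y : 𝓞 M) :
      k • algebraMap (𝓞 M) (𝓞 (Fbar F)) y =
        algebraMap (𝓞 M) (𝓞 (Fbar F)) (AlgEquiv.restrictNormalHom M k • y) := by
    ext
    exact (AlgEquiv.restrictNormal_commutes k M (y : M)).symm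
  let : TopologicalSpace (𝓞 (Fbar F)) := ⊥
  have : DiscreteTopology (𝓞 (Fbar F)) := ⟨rfl⟩
  have := continuousSMul_integers M
  have hstab := Ideal.inertia_le_stabilizer (P.under (𝓞 M)) hg
  have hunder : (g' • P).under (𝓞 M) = P.under (𝓞 M) := by
    ext y
    rw [Ideal.mem_comap, Ideal.mem_pointwise_smul_iff_inv_smul_mem, key]
    have h2 : AlgEquiv.restrictNormalHom M g'⁻¹ • y ∈ P.under (𝓞 M) ↔ y ∈ P.under (𝓞 M) := by
      conv_rhs => rw [← hstab, Ideal.mem_pointwise_smul_iff_inv_smul_mem]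
      rw [map_inv]
    exact h2
  have : (g' • P).IsPrime := Ideal.IsPrime.smul g'
  -- An arbitrary lift `g'` may move `P`, but only to a prime with the same trace on `M`; an element
  -- of `Gal(F̄/M)` moves it back.
  obtain ⟨h, hh⟩ := Algebra.IsInvariant.exists_smul_of_under_eq_of_profinite
    (A := 𝓞 M) (G := Gal(Fbar F/M)) (g' • P) P hunder
  let res : Gal(Fbar F/M) → GF F := AlgEquiv.restrictScalars F
  have res_smul (h : Gal(Fbar F/M)) (z : 𝓞 (Fbar F)) : res h • z = h • z := rfl
  have res_one (h : Gal(Fbar F/M)) : AlgEquiv.restrictNormalHom M (res h) = 1 := by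
    ext y
    have := AlgEquiv.restrictNormal_commutes (res h) M y
    refine congrArg Subtype.val ((algebraMap M (Fbar F)).injective (this.trans ?_))
    exact h.commutes y
  set k : GF F := res h * g' with hk
  have hkP : k • P = P := by
    rw [hk, mul_smul]
    exact hh.symm
  have hkr : AlgEquiv.restrictNormalHom M k = AlgEquiv.restrictNormalHom M g' := by
    rw [hk, map_mul, res_one, one_mul]
  let σ₀ : (𝓞 (Fbar F) ⧸ P) ≃+* (𝓞 (Fbar F) ⧸ P) :=
    Ideal.quotientEquiv P P (MulSemiringAction.toRingEquiv (GF F) (𝓞 (Fbar F)) k) (by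
      conv_lhs => rw [← hkP]
      rfl)
  have hσ₀ (z : 𝓞 (Fbar F)) : σ₀ (Ideal.Quotient.mk P z) = Ideal.Quotient.mk P (k • z) := rfl
  -- Since `g` is inertial, `k` acts on the residue ring linearly over that of `M`, hence as some
  -- `h₂` in the decomposition group inside `Gal(F̄/M)`. Dividing by `h₂` makes `k` inertial without
  -- changing its restriction to `M`.
  let σ : (𝓞 (Fbar F) ⧸ P) ≃ₐ[𝓞 M ⧸ P.under (𝓞 M)] (𝓞 (Fbar F) ⧸ P) :=
    AlgEquiv.ofRingEquiv (f := σ₀) (by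
      intro y
      obtain ⟨y, rfl⟩ := Ideal.Quotient.mk_surjective y
      change σ₀ (Ideal.Quotient.mk P (algebraMap (𝓞 M) (𝓞 (Fbar F)) y)) =
        Ideal.Quotient.mk P (algebraMap (𝓞 M) (𝓞 (Fbar F)) y)
      rw [hσ₀, Ideal.Quotient.eq, key, ← map_sub, hkr]
      exact hg y)
  obtain ⟨h₂, hh₂⟩ := Ideal.Quotient.stabilizerHom_surjective_of_profinite
    (G := Gal(Fbar F/M)) (P.under (𝓞 M)) P σ
  refine ⟨(res h₂.1)⁻¹ * k, fun z => ?_, by rw [map_mul, map_inv, res_one, hkr]; simp⟩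
  have h1 : Ideal.Quotient.mk P (h₂.1 • z) = Ideal.Quotient.mk P (k • z) := by
    rw [← hσ₀]
    exact congrArg (fun f => f (Ideal.Quotient.mk P z)) hh₂
  rw [Ideal.Quotient.eq] at h1
  have h3 : (res h₂.1) • P = P := h₂.2
  change ((res h₂.1)⁻¹ * k) • z - z ∈ P
  rw [← Ideal.smul_mem_pointwise_smul_iff (a := res h₂.1), h3, smul_sub, smul_smul,
    mul_inv_cancel_left, ← neg_mem_iff, neg_sub]
  exact h1

theorem card_inertia_eq_ramificationIdx' {E L : Type*} [Field E] [NumberField E] [Field L]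
    [NumberField L] [Algebra E L] (G : Type*) [Group G] [Finite G] [MulSemiringAction G L]
    [IsGaloisGroup G E L]
    (u : IsDedekindDomain.HeightOneSpectrum (𝓞 E)) (w : IsDedekindDomain.HeightOneSpectrum (𝓞 L))
    [w.asIdeal.LiesOver u.asIdeal] :
    Nat.card (w.asIdeal.inertia G) = u.asIdeal.ramificationIdx' w.asIdeal := by
  have := u.isPrime
  have := u.isMaximal
  have := w.isPrime
  have : Finite (𝓞 E ⧸ u.asIdeal) := Ring.HasFiniteQuotients.finiteQuotient u.ne_bot
  rw [Ideal.card_inertia_eq_ramificationIdxIn u.asIdeal w.asIdeal,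
    Ideal.ramificationIdxIn_eq_ramificationIdx u.asIdeal w.asIdeal G,
    Ideal.ramificationIdx'_eq_ramificationIdx _ _ u.ne_bot]

open IsDedekindDomain in
/-- If an `N`-th root of `x` is fixed by an inertia group at `v`, then `N` divides the valuation
of `x` at `v`. -/
theorem dvd_multiplicity_of_inertia_fixed [NumberField F] (v : HeightOneSpectrum (𝓞 F))
    (P : Ideal (𝓞 (Fbar F))) [P.IsPrime]
    (hP : P.comap (algebraMap (𝓞 F) (𝓞 (Fbar F))) = v.asIdeal) {N : ℕ} {x : 𝓞 F} (hx : x ≠ 0)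
    {α : Fbar F} (hα : α ^ N = algebraMap F (Fbar F) x) (hN : N ≠ 0)
    (hfix : ∀ g ∈ P.inertia (GF F), g α = α) :
    N ∣ multiplicity v.asIdeal (Ideal.span {x}) := by
  have hαint : IsIntegral ℤ α := by
    refine IsIntegral.of_pow (Nat.pos_of_ne_zero hN) ?_
    rw [hα]
    exact x.isIntegral_coe.map (IsScalarTower.toAlgHom ℤ F (Fbar F))
  let M : IntermediateField F (Fbar F) :=
    IntermediateField.normalClosure F (IntermediateField.adjoin F {α}) (Fbar F)
  have : FiniteDimensional F (IntermediateField.adjoin F {α}) :=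
    IntermediateField.adjoin.finiteDimensional (Algebra.IsIntegral.isIntegral α)
  have hαM : α ∈ M := IntermediateField.le_normalClosure _
    (IntermediateField.mem_adjoin_simple_self F α)
  have : NumberField M := NumberField.of_module_finite F M
  let PM := P.under (𝓞 M)
  have hPM : PM.under (𝓞 F) = v.asIdeal := by rw [Ideal.under_under]; exact hP
  have : PM.LiesOver v.asIdeal := ⟨hPM.symm⟩
  let w : HeightOneSpectrum (𝓞 M) := ⟨PM, inferInstance,
    Ideal.ne_bot_of_liesOver_of_ne_bot v.ne_bot PM⟩
  let H := PM.inertia Gal(M/F)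
  -- The inertia field: `M/E` and `M/F` have the same ramification index at `w`, so valuations at
  -- `u` and `v` agree on `F`. Since `α ∈ E`, the valuation of `x = α ^ N` is `N` times an integer.
  let E : IntermediateField F M := FixedPoints.intermediateField H
  have : NumberField E := NumberField.of_module_finite F E
  have hαE : (⟨α, hαM⟩ : M) ∈ E := by
    intro h
    obtain ⟨k, hk, hkh⟩ := exists_mem_inertia_restrictNormalHom_eq M P h.1 h.2
    have h1 := AlgEquiv.restrictNormal_commutes k M ⟨α, hαM⟩
    have h2 : h • (⟨α, hαM⟩ : M) = AlgEquiv.restrictNormalHom M k ⟨α, hαM⟩ := by rw [hkh]; rfl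
    rw [h2]
    refine (algebraMap M (Fbar F)).injective (h1.trans ?_)
    exact hfix k hk
  let a' : E := ⟨⟨α, hαM⟩, hαE⟩
  have ha' : IsIntegral ℤ a' := by
    rw [← isIntegral_algebraMap_iff (algebraMap E M).injective,
      ← isIntegral_algebraMap_iff (algebraMap M (Fbar F)).injective]
    exact hαint
  let a : 𝓞 E := ⟨a', ha'⟩
  have hax : algebraMap (𝓞 F) (𝓞 M) x = algebraMap (𝓞 E) (𝓞 M) a ^ N := by
    ext
    exact hα.symm
  have ha0 : a ≠ 0 := by
    rintro h
    rw [h, map_zero, zero_pow hN] at hax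
    exact hx ((FaithfulSMul.algebraMap_injective (𝓞 F) (𝓞 M)) (by rw [hax, map_zero]))
  let u : HeightOneSpectrum (𝓞 E) := ⟨PM.under (𝓞 E), inferInstance,
    Ideal.under_ne_bot _ w.ne_bot⟩
  have : w.asIdeal.LiesOver u.asIdeal := ⟨rfl⟩
  have : w.asIdeal.LiesOver v.asIdeal := ⟨hPM.symm⟩
  have e1 := card_inertia_eq_ramificationIdx' Gal(M/F) v w
  have e2 := card_inertia_eq_ramificationIdx' H u w
  have e3 : Nat.card (w.asIdeal.inertia H) = Nat.card (w.asIdeal.inertia Gal(M/F)) := by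
    have : w.asIdeal.inertia H = ⊤ := by
      refine (w.asIdeal.toAddSubgroup.subgroupOf_inertia H).symm.trans ?_
      exact Subgroup.subgroupOf_self _
    rw [this, Subgroup.card_top]
  have h1 := v.intValuation_liesOver w x
  have h2 := u.intValuation_liesOver w a
  rw [hax, map_pow, ← h2, ← e3.symm.trans e2, ← e1, v.intValuation_eq_exp_neg_multiplicity hx,
    u.intValuation_eq_exp_neg_multiplicity ha0] at h1
  simp only [← WithZero.exp_nsmul, WithZero.exp_inj] at h1
  have he : Nat.card (w.asIdeal.inertia Gal(M/F)) ≠ 0 := Nat.card_pos.ne'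
  refine ⟨multiplicity u.asIdeal (Ideal.span {a}), ?_⟩
  have h3 : (Nat.card (w.asIdeal.inertia Gal(M/F)) : ℤ) * multiplicity v.asIdeal (Ideal.span {x}) =
      Nat.card (w.asIdeal.inertia Gal(M/F)) * (N * multiplicity u.asIdeal (Ideal.span {a})) := by
    simp only [nsmul_eq_mul] at h1
    linarith
  exact_mod_cast mul_left_cancel₀ (by exact_mod_cast he) h3

end Inertia
-- Kummer theory modulo `p ^ n` for `ℤ_p(1)`-valued cocycles.
section Kummer

open Topology

variable {F : Type*} [Field F] [CharZero F] {p : ℕ} [Fact p.Prime]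

variable (F p) in
/-- A chosen primitive `p ^ n`-th root of unity in `F̄`. -/
def zetaPow (n : ℕ) : Fbar F := (HasEnoughRootsOfUnity.exists_primitiveRoot (Fbar F) (p ^ n)).choose

theorem zetaPow_spec (n : ℕ) : IsPrimitiveRoot (zetaPow F p n) (p ^ n) :=
  (HasEnoughRootsOfUnity.exists_primitiveRoot (Fbar F) (p ^ n)).choose_spec

variable (F) in
/-- The map `ℤ_p → μ_{p^n}`, `t ↦ ζ ^ t`. -/
def rootPow (n : ℕ) (t : ℤ_[p]) : Fbar F := zetaPow F p n ^ (PadicInt.toZModPow n t).val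

theorem zetaPow_pow_eq {n a b : ℕ} (h : (a : ZMod (p ^ n)) = b) :
    zetaPow F p n ^ a = zetaPow F p n ^ b := by
  rw [ZMod.natCast_eq_natCast_iff] at h
  have h1 := (zetaPow_spec (F := F) (p := p) n).pow_eq_one
  rw [pow_eq_pow_mod a h1, pow_eq_pow_mod b h1, h]

theorem rootPow_add (n : ℕ) (s t : ℤ_[p]) :
    rootPow F n (s + t) = rootPow F n s * rootPow F n t := by
  rw [rootPow, rootPow, rootPow, ← pow_add]
  exact zetaPow_pow_eq (by simp)

theorem rootPow_pow (n k : ℕ) (t : ℤ_[p]) : rootPow F n t ^ k = rootPow F n ((k : ℤ_[p]) * t) := by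
  rw [rootPow, rootPow, ← pow_mul]
  exact zetaPow_pow_eq (by simp [mul_comm])

theorem rootPow_eq_one_iff (n : ℕ) (t : ℤ_[p]) :
    rootPow F n t = 1 ↔ (p : ℤ_[p]) ^ n ∣ t := by
  rw [rootPow, (zetaPow_spec n).pow_eq_one_iff_dvd, ← ZMod.natCast_eq_zero_iff,
    ZMod.natCast_zmod_val, ← RingHom.mem_ker, PadicInt.ker_toZModPow, Ideal.mem_span_singleton]

theorem rootPow_zero (n : ℕ) : rootPow F n (0 : ℤ_[p]) = 1 :=
  (rootPow_eq_one_iff n 0).mpr (dvd_zero _)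

theorem rootPow_pow_prime_pow (n : ℕ) (t : ℤ_[p]) : rootPow F n t ^ p ^ n = 1 := by
  rw [rootPow_pow, rootPow_eq_one_iff, Nat.cast_pow]
  exact dvd_mul_right _ _

theorem rootPow_ne_zero (n : ℕ) (t : ℤ_[p]) : rootPow F n t ≠ 0 := fun h => by
  have := rootPow_pow_prime_pow (F := F) n t
  rw [h, zero_pow (pow_ne_zero _ (Fact.out : p.Prime).ne_zero)] at this
  exact zero_ne_one this

theorem rootPow_congr {n : ℕ} {s t : ℤ_[p]} (h : (p : ℤ_[p]) ^ n ∣ s - t) :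
    rootPow F n s = rootPow F n t := by
  rw [← sub_add_cancel s t, rootPow_add, (rootPow_eq_one_iff n _).mpr h, one_mul]

theorem map_rootPow (n : ℕ) (g : GF F) (t : ℤ_[p]) :
    g (rootPow F n t) = rootPow F n ((cyc F p g : ℤ_[p]) * t) := by
  have h := cyclotomicCharacter.spec p (n := n) (MulSemiringAction.toRingAut (GF F) (Fbar F) g)
    (rootPow F n t) (rootPow_pow_prime_pow n t)
  change g (rootPow F n t) = _ at h
  rw [h, rootPow, ← pow_mul, rootPow]
  refine zetaPow_pow_eq ?_
  push_cast
  rw [ZMod.natCast_zmod_val, ZMod.natCast_zmod_val, ZMod.natCast_zmod_val, map_mul, mul_comm]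
  rfl

/-- A `ℤ_p(1)`-valued cocycle that is locally constant modulo `p ^ n` is a Kummer cocycle modulo
`p ^ n`. -/
theorem exists_kummer_generator {b : GF F → ℤ_[p]}
    (hb : ∀ g h, b (g * h) = b g + cyc F p g * b h) {n : ℕ}
    (hn : {g | (p : ℤ_[p]) ^ n ∣ b g} ∈ 𝓝 (1 : GF F)) :
    ∃ α : Fbar F, α ≠ 0 ∧ ∀ g : GF F, g α = rootPow F n (b g) * α := by
  have hζ : {g : GF F | g (zetaPow F p n) = zetaPow F p n} ∈ 𝓝 (1 : GF F) :=
    (stabilizer_isOpen_of_isIntegral (zetaPow F p n)).mem_nhds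
      (one_mem (MulAction.stabilizer (GF F) (zetaPow F p n)))
  -- `M` must both trivialize `b` mod `p ^ n` and contain `ζ`, so that the cocycle descends to
  -- `Gal(M/F)` with values in `Mˣ`, where Hilbert 90 applies.
  obtain ⟨M, hM, hM', hMs⟩ := (krullTopology_mem_nhds_one_iff_of_normal F (Fbar F) _).mp
    (Filter.inter_mem hn hζ)
  have hζM : zetaPow F p n ∈ M := by
    rw [← InfiniteGalois.fixedField_fixingSubgroup M]
    exact fun h => (hMs h.2).2
  let f : GF F → Mˣ := fun g =>
    Units.mk0 ⟨rootPow F n (b g), pow_mem hζM _⟩ fun h => rootPow_ne_zero n (b g)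
      (congrArg Subtype.val h)
  have hf (g h : GF F) (hgh : AlgEquiv.restrictNormalHom M g = AlgEquiv.restrictNormalHom M h) :
      f g = f h := by
    have h1 : h⁻¹ * g ∈ M.fixingSubgroup := by
      rw [← IntermediateField.restrictNormalHom_ker, MonoidHom.mem_ker, map_mul, map_inv, hgh,
        inv_mul_cancel]
    ext
    refine rootPow_congr (p := p) ?_
    rw [← mul_inv_cancel_left h g, hb, add_sub_cancel_left]
    exact (hMs h1).1.mul_left _
  let lift : Gal(M/F) → GF F :=
    Function.surjInv (AlgEquiv.restrictNormalHom_surjective (F := F) (K₁ := M) (Fbar F))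
  have hlift (s : Gal(M/F)) : AlgEquiv.restrictNormalHom M (lift s) = s :=
    Function.surjInv_eq _ s
  have hcoc : groupCohomology.IsMulCocycle₁ fun s => f (lift s) := by
    intro s t
    change f (lift (s * t)) = _
    rw [hf (lift (s * t)) (lift s * lift t) (by simp [hlift])]
    ext
    change rootPow F n (b (lift s * lift t)) =
      ((s (f (lift t) : M) : M) : Fbar F) * rootPow F n (b (lift s))
    rw [hb, rootPow_add, mul_comm, ← map_rootPow]
    congr 1
    conv_rhs => rw [← hlift s]
    exact (AlgEquiv.restrictNormal_commutes (lift s) M (f (lift t) : M)).symm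
  obtain ⟨β, hβ⟩ := groupCohomology.isMulCoboundary₁_of_isMulCocycle₁_of_aut_to_units _ hcoc
  refine ⟨((β : M) : Fbar F), by simp, fun g => ?_⟩
  have h1 := hβ (AlgEquiv.restrictNormalHom M g)
  change _ = f (lift (AlgEquiv.restrictNormalHom M g)) at h1
  rw [hf _ g (hlift _), div_eq_iff_eq_mul] at h1
  have h2 := congrArg (fun u : Mˣ => ((u : M) : Fbar F)) h1
  exact (AlgEquiv.restrictNormal_commutes g M (β : M)).symm.trans h2

/-- Scaling `α` by a nonzero integer makes it integral without changing its cocycle, and `α ^ p ^ n`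
is Galois-invariant because the cocycle takes values in `μ_{p^n}`. -/
theorem exists_integral_kummer_generator [NumberField F] {b : GF F → ℤ_[p]}
    (hb : ∀ g h, b (g * h) = b g + cyc F p g * b h) {n : ℕ}
    (hn : {g | (p : ℤ_[p]) ^ n ∣ b g} ∈ 𝓝 (1 : GF F)) :
    ∃ (α : Fbar F) (x : 𝓞 F), x ≠ 0 ∧ α ^ p ^ n = algebraMap F (Fbar F) x ∧
      ∀ g : GF F, g α = rootPow F n (b g) * α := by
  obtain ⟨α, hα, hg⟩ := exists_kummer_generator hb hn
  have : Algebra.IsIntegral ℚ (Fbar F) := Algebra.IsIntegral.trans F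
  obtain ⟨m, hm⟩ := IsIntegral.exists_multiple_integral_of_isLocalization (nonZeroDivisors ℤ)
    (Rₘ := ℚ) α (Algebra.IsIntegral.isIntegral α)
  have hm0 : (m : ℤ) ≠ 0 := nonZeroDivisors.coe_ne_zero m
  have hm' : m • α = ((m : ℤ) : Fbar F) * α := zsmul_eq_mul α (m : ℤ)
  rw [hm'] at hm
  set α' : Fbar F := ((m : ℤ) : Fbar F) * α
  have hg' (g : GF F) : g α' = rootPow F n (b g) * α' := by
    rw [map_mul, map_intCast, hg]
    ring
  have hfix (g : GF F) : g (α' ^ p ^ n) = α' ^ p ^ n := by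
    rw [map_pow, hg', mul_pow, rootPow_pow_prime_pow, one_mul]
  obtain ⟨x, hx⟩ := (InfiniteGalois.mem_bot_iff_fixed (α' ^ p ^ n)).mpr hfix
  have hx' : algebraMap F (Fbar F) x = α' ^ p ^ n := hx
  have hxi : IsIntegral ℤ x := by
    rw [← isIntegral_algebraMap_iff (algebraMap F (Fbar F)).injective, hx']
    exact hm.pow _
  have hα0 : α' ≠ 0 := mul_ne_zero (Int.cast_ne_zero.mpr hm0) hα
  refine ⟨α', ⟨x, hxi⟩, fun h => ?_, hx'.symm, hg'⟩
  have h0 : x = 0 := congrArg Subtype.val h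
  rw [h0, map_zero] at hx'
  exact pow_ne_zero _ hα0 hx'.symm

end Kummer
-- Primes above `p` from `p`-adic embeddings; local splitting and norms.
section PadicPlaces

variable {p : ℕ} [Fact p.Prime]

theorem norm_le_one_of_isIntegral {z : PadicAlgCl p} (hz : IsIntegral ℤ z) : ‖z‖ ≤ 1 := by
  have h := Valuation.Integers.mem_of_integral
    (Valuation.integer.integers (Valued.v : Valuation (PadicAlgCl p) NNReal))
    (IsIntegral.tower_top (R := ℤ) hz)
  exact h

theorem norm_algEquiv (τ : PadicAlgCl p ≃ₐ[ℚ_[p]] PadicAlgCl p) (z : PadicAlgCl p) :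
    ‖τ z‖ = ‖z‖ := by
  rw [← PadicAlgCl.spectralNorm_eq, ← PadicAlgCl.spectralNorm_eq]
  exact (spectralNorm_eq_of_equiv τ z).symm

variable {F : Type*} [Field F]

/-- The prime of the ring of algebraic integers of `F̄` cut out by a `p`-adic embedding. -/
def placeIdeal (σ : Fbar F →+* PadicAlgCl p) : Ideal (𝓞 (Fbar F)) where
  carrier := {z | ‖σ z‖ < 1}
  zero_mem' := by simp
  add_mem' {a b} ha hb := by
    simp only [Set.mem_ofPred_eq, map_add] at *
    exact (PadicAlgCl.isNonarchimedean p _ _).trans_lt (max_lt ha hb)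
  smul_mem' c a ha := by
    simp only [Set.mem_ofPred_eq, smul_eq_mul, map_mul, norm_mul] at *
    exact mul_lt_one_of_nonneg_of_lt_one_right
      (norm_le_one_of_isIntegral (c.isIntegral_coe.map σ.toIntAlgHom)) (norm_nonneg _) ha

theorem mem_placeIdeal {σ : Fbar F →+* PadicAlgCl p} {z : 𝓞 (Fbar F)} :
    z ∈ placeIdeal σ ↔ ‖σ z‖ < 1 := Iff.rfl

instance placeIdeal_isPrime (σ : Fbar F →+* PadicAlgCl p) : (placeIdeal σ).IsPrime where
  ne_top' h := by
    have : (1 : 𝓞 (Fbar F)) ∈ placeIdeal σ := by rw [h]; trivial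
    simp [mem_placeIdeal] at this
  mem_or_mem' {x y} hxy := by
    simp only [mem_placeIdeal, map_mul, norm_mul] at *
    by_contra! h
    exact hxy.not_ge (one_le_mul_of_one_le_of_one_le h.1 h.2)

theorem natCast_mem_placeIdeal (σ : Fbar F →+* PadicAlgCl p) :
    (p : 𝓞 (Fbar F)) ∈ placeIdeal σ := by
  have h : ((p : 𝓞 (Fbar F)) : Fbar F) = p := map_natCast (algebraMap _ _) p
  rw [mem_placeIdeal, h, map_natCast, ← map_natCast (algebraMap ℚ_[p] (PadicAlgCl p)),
    norm_algebraMap']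
  exact Padic.norm_p_lt_one

/-- Automorphisms of the algebraic closure of `ℚ_p` are isometries, so their restrictions to `F̄`
lie in the decomposition group. -/
theorem mem_stabilizer_placeIdeal {σ : Fbar F →+* PadicAlgCl p}
    {τ : PadicAlgCl p ≃ₐ[ℚ_[p]] PadicAlgCl p} {g : GF F} (h : ∀ x, τ (σ x) = σ (g x)) :
    g ∈ MulAction.stabilizer (GF F) (placeIdeal σ) := by
  rw [← inv_mem_iff, MulAction.mem_stabilizer_iff]
  ext z
  rw [Ideal.mem_pointwise_smul_iff_inv_smul_mem, inv_inv, mem_placeIdeal, mem_placeIdeal,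
    coe_smul_integer, ← h, norm_algEquiv]

/-- An automorphism of `Ω` fixing the image of `F` restricts to `F̄`. -/
theorem exists_restrict_embedding [CharZero F] {Ω : Type*} [Field Ω] (σ : Fbar F →+* Ω) (τ : Ω ≃+* Ω)
    (h : ∀ x : F, τ (σ (algebraMap F (Fbar F) x)) = σ (algebraMap F (Fbar F) x)) :
    ∃ g : GF F, ∀ x, τ (σ x) = σ (g x) := by
  let _ : Algebra (Fbar F) Ω := σ.toAlgebra
  let _ : Algebra F Ω := (σ.comp (algebraMap F (Fbar F))).toAlgebra
  have : IsScalarTower F (Fbar F) Ω := .of_algebraMap_eq fun _ => rfl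
  let τ' : Ω ≃ₐ[F] Ω := AlgEquiv.ofRingEquiv (f := τ) h
  exact ⟨τ'.restrictNormal (Fbar F), fun x => (τ'.restrictNormal_commutes (Fbar F) x).symm⟩

theorem exists_extend_embedding {Ω : Type*} [Field Ω] [IsAlgClosed Ω] (j : F →+* Ω) :
    ∃ σ : Fbar F →+* Ω, ∀ x : F, σ (algebraMap F (Fbar F) x) = j x := by
  let _ : Algebra F Ω := j.toAlgebra
  exact ⟨(IsAlgClosed.lift : Fbar F →ₐ[F] Ω).toRingHom, fun x => AlgHom.commutes _ x⟩

variable [NumberField F]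

theorem exists_root_of_local_splitting {b : GF F → ℤ_[p]} {σ : Fbar F →+* PadicAlgCl p} {t : ℤ_[p]}
    (ht : ∀ g ∈ MulAction.stabilizer (GF F) (placeIdeal σ), b g = (cyc F p g - 1) * t)
    {n : ℕ} {α : Fbar F} {x : F} (hα : α ^ p ^ n = algebraMap F (Fbar F) x)
    (hg : ∀ g : GF F, g α = rootPow F n (b g) * α) :
    ∃ β : PadicAlgCl p, β ^ p ^ n = σ (algebraMap F (Fbar F) x) ∧
      ∀ τ : PadicAlgCl p ≃ₐ[ℚ_[p]] PadicAlgCl p,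
        (∀ y : F, τ (σ (algebraMap F (Fbar F) y)) = σ (algebraMap F (Fbar F) y)) → τ β = β := by
  -- Twisting by `ζ ^ (-t)` cancels the local coboundary `(χ - 1) * t`, leaving a root fixed by the
  -- decomposition group.
  refine ⟨σ (rootPow F n (-t) * α), ?_, fun τ hτ => ?_⟩
  · rw [← map_pow, mul_pow, rootPow_pow_prime_pow, one_mul, hα]
  · obtain ⟨g, hgτ⟩ := exists_restrict_embedding σ τ.toRingEquiv hτ
    have h1 := ht g (mem_stabilizer_placeIdeal (τ := τ) hgτ)
    refine (hgτ _).trans (congrArg σ ?_)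
    rw [map_mul, map_rootPow, hg, h1, ← mul_assoc, ← rootPow_add]
    congr 2
    ring

variable (F p) in
-- The global norm is the product of all `p`-adic conjugates. By Galois theory the roots `β` lie in
-- the field `L` generated over `ℚ_p` by all images of `F`, so the norm is an `N`-th power in `L`;
-- applying the norm from `L` to `ℚ_p` gives `d = [L : ℚ_p]`, independent of `N` and `x`.
theorem exists_finrank_norm_pow_eq_pow : ∃ d : ℕ, 0 < d ∧ ∀ (N : ℕ) (x : F),
    (∀ j : F →ₐ[ℚ] PadicAlgCl p, ∃ β : PadicAlgCl p, β ^ N = j x ∧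
      ∀ τ : PadicAlgCl p ≃ₐ[ℚ_[p]] PadicAlgCl p, (∀ y : F, τ (j y) = j y) → τ β = β) →
    ∃ W : ℚ_[p], ((Algebra.norm ℚ x : ℚ) : ℚ_[p]) ^ d = W ^ N := by
  obtain ⟨θ, hθ⟩ := Field.exists_primitive_element ℚ F
  let S : Set (PadicAlgCl p) := Set.range fun j : F →ₐ[ℚ] PadicAlgCl p => j θ
  let L : IntermediateField ℚ_[p] (PadicAlgCl p) := IntermediateField.adjoin ℚ_[p] S
  have : Finite S := Set.finite_range _
  have hfd : FiniteDimensional ℚ_[p] L :=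
    IntermediateField.finiteDimensional_adjoin fun z _ => Algebra.IsIntegral.isIntegral z
  have hjL (j : F →ₐ[ℚ] PadicAlgCl p) (y : F) : j y ∈ L := by
    have hy : y ∈ IntermediateField.adjoin ℚ {θ} := by rw [hθ]; trivial
    induction hy using IntermediateField.adjoin_induction with
    | mem z hz =>
      rw [Set.mem_singleton_iff.mp hz]
      exact IntermediateField.subset_adjoin _ _ ⟨j, rfl⟩
    | algebraMap q => simp
    | add u v _ _ hu hv => rw [map_add]; exact add_mem hu hv
    | inv u _ hu => rw [map_inv₀]; exact inv_mem hu
    | mul u v _ _ hu hv => rw [map_mul]; exact mul_mem hu hv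
  refine ⟨Module.finrank ℚ_[p] L, Module.finrank_pos, fun N x h => ?_⟩
  choose β hβ hβτ using h
  have hβL (j : F →ₐ[ℚ] PadicAlgCl p) : β j ∈ L := by
    have : IsGalois L (PadicAlgCl p) := IsGalois.tower_top_intermediateField L
    obtain ⟨y, hy⟩ := (InfiniteGalois.mem_bot_iff_fixed (k := L) (β j)).mpr fun τ =>
      hβτ j (τ.restrictScalars ℚ_[p]) fun y => τ.commutes ⟨j y, hjL j y⟩
    rw [← hy]
    exact y.2
  let B : L := ∏ j, ⟨β j, hβL j⟩
  have hB : algebraMap ℚ_[p] L ((Algebra.norm ℚ x : ℚ) : ℚ_[p]) = B ^ N := by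
    refine (algebraMap L (PadicAlgCl p)).injective ?_
    have h1 := Algebra.norm_eq_prod_embeddings ℚ (PadicAlgCl p) x
    rw [← IsScalarTower.algebraMap_apply, map_ratCast, map_pow, map_prod]
    rw [eq_ratCast] at h1
    rw [h1, ← Finset.prod_pow]
    exact Finset.prod_congr rfl fun j _ => (hβ j).symm
  refine ⟨Algebra.norm ℚ_[p] B, ?_⟩
  rw [← map_pow, ← hB, Algebra.norm_algebraMap]

end PadicPlaces
-- Ideal norms and lifting the exponent: the bound uniform in `n`.
section Arithmetic

open IsDedekindDomain in
/-- If the multiplicities of `I` away from `l` and `p` are divisible by `N`, its norm is a power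
of the norm of `l`, up to `N`-th powers and powers of `p`. -/
theorem exists_absNorm_eq_mul_pow_mul_pow {F : Type*} [Field F] [NumberField F] {p : ℕ}
    [Fact p.Prime] (l : HeightOneSpectrum (𝓞 F)) {N : ℕ} {I : Ideal (𝓞 F)} (hI : I ≠ ⊥)
    (h : ∀ v : HeightOneSpectrum (𝓞 F), v ≠ l → (p : 𝓞 F) ∉ v.asIdeal →
      N ∣ multiplicity v.asIdeal I) :
    ∃ Y s : ℕ, Y ≠ 0 ∧
      Ideal.absNorm I = Ideal.absNorm l.asIdeal ^ multiplicity l.asIdeal I * Y ^ N * p ^ s := by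
  classical
  have hfin : (Function.mulSupport fun v : HeightOneSpectrum (𝓞 F) =>
      v.asIdeal ^ multiplicity v.asIdeal I).Finite := by
    have := Ideal.hasFiniteMulSupport hI
    simpa only [Function.HasFiniteMulSupport,
      HeightOneSpectrum.maxPowDividing_eq_pow_multiplicity hI] using this
  have key (S : Finset (HeightOneSpectrum (𝓞 F))) (hS : l ∉ S) : ∃ Y s : ℕ, Y ≠ 0 ∧
      ∏ v ∈ S, Ideal.absNorm v.asIdeal ^ multiplicity v.asIdeal I = Y ^ N * p ^ s := by
    induction S using Finset.induction_on with
    | empty => exact ⟨1, 0, one_ne_zero, by simp⟩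
    | insert v S hv ih =>
      rw [Finset.mem_insert, not_or] at hS
      obtain ⟨Y, s, hY, hYs⟩ := ih hS.2
      have hv0 : Ideal.absNorm v.asIdeal ≠ 0 := Ideal.absNorm_eq_zero_iff.not.mpr v.ne_bot
      rw [Finset.prod_insert hv, hYs]
      by_cases hp : (p : 𝓞 F) ∈ v.asIdeal
      · have hdvd := Ideal.absNorm_dvd_absNorm_of_le ((Ideal.span_singleton_le_iff_mem _).mpr hp)
        rw [Ideal.absNorm_span_natCast] at hdvd
        obtain ⟨r, -, hr⟩ := (Nat.dvd_prime_pow Fact.out).mp hdvd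
        exact ⟨Y, r * multiplicity v.asIdeal I + s, hY, by rw [hr, ← pow_mul]; ring⟩
      · obtain ⟨m, hm⟩ := h v (Ne.symm hS.1) hp
        exact ⟨Ideal.absNorm v.asIdeal ^ m * Y, s, mul_ne_zero (pow_ne_zero _ hv0) hY, by
          rw [hm, mul_comm N m, pow_mul]; ring⟩
  -- Erasing `l` and inserting it again isolates its factor even when its multiplicity is zero.
  obtain ⟨Y, s, hY, hYs⟩ := key (hfin.toFinset.erase l) (Finset.notMem_erase _ _)
  refine ⟨Y, s, hY, ?_⟩
  have h1 := finprod_eq_prod_of_mulSupport_subset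
    (fun v : HeightOneSpectrum (𝓞 F) => v.asIdeal ^ multiplicity v.asIdeal I)
    (s := insert l (hfin.toFinset.erase l)) (fun v hv => by
      by_cases hvl : v = l
      · simp [hvl]
      · simpa [hvl] using hv)
  rw [Ideal.finprod_heightOneSpectrum_pow_multiplicity hI,
    Finset.prod_insert (Finset.notMem_erase _ _)] at h1
  conv_lhs => rw [h1]
  simp only [map_mul, map_prod, map_pow]
  rw [hYs, mul_assoc]

/-- A lifting-the-exponent bound valid for all primes. -/
theorem prime_pow_dvd_of_dvd_pow_sub_one {p : ℕ} [hp : Fact p.Prime] {M : ℤ} (h : (p : ℤ) ∣ M - 1)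
    (h4 : p = 2 → 4 ∣ M - 1) {n e : ℕ} (hn : (p : ℤ) ^ n ∣ M ^ e - 1) :
    (p : ℤ) ^ n ∣ (M - 1) * e := by
  have hpM : ¬ (p : ℤ) ∣ M := fun hM => by
    have : (p : ℤ) ∣ 1 := by simpa using dvd_sub hM h
    exact hp.out.one_lt.ne' (by exact_mod_cast Int.eq_one_of_dvd_one (by positivity) this)
  have key : emultiplicity (p : ℤ) (M ^ e - 1) =
      emultiplicity (p : ℤ) (M - 1) + emultiplicity (p : ℤ) e := by
    rcases hp.out.eq_two_or_odd' with rfl | hodd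
    · simpa using Int.two_pow_sub_pow' (y := 1) e (h4 rfl) hpM
    · have := Int.emultiplicity_pow_sub_pow hp.out hodd (y := 1) h hpM e
      rwa [one_pow, ← Int.natCast_emultiplicity] at this
  rw [pow_dvd_iff_le_emultiplicity] at hn ⊢
  rwa [emultiplicity_mul (Nat.prime_iff_prime_int.mp hp.out), ← key]

/-- Since `Q` is a `p`-adic unit, comparing valuations of `W / Y` shows that `p ^ s` is itself an
`N`-th power; dividing it out leaves a unit. -/
theorem exists_padicInt_unit_pow {p : ℕ} [Fact p.Prime] {Q N : ℕ} (hQ : Q.Coprime p)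
    {a s Y : ℕ} (hY : Y ≠ 0) (hN : N ≠ 0) {W : ℚ_[p]}
    (h : (Q : ℚ_[p]) ^ a * (Y : ℚ_[p]) ^ N * (p : ℚ_[p]) ^ s = W ^ N) :
    ∃ u : ℤ_[p]ˣ, (Q : ℤ_[p]) ^ a = (u : ℤ_[p]) ^ N := by
  have hp0 : (p : ℚ_[p]) ≠ 0 := Nat.cast_ne_zero.mpr (Fact.out : p.Prime).ne_zero
  have hY0 : (Y : ℚ_[p]) ≠ 0 := Nat.cast_ne_zero.mpr hY
  have hQn : ‖(Q : ℚ_[p])‖ = 1 := by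
    rw [Padic.norm_natCast_eq_one_iff]
    exact hQ.symm
  set Z : ℚ_[p] := W / Y with hZ
  have hZN : Z ^ N = (Q : ℚ_[p]) ^ a * (p : ℚ_[p]) ^ s := by
    rw [hZ, div_pow, ← h]
    field_simp
  have hZ0 : Z ≠ 0 := by
    rintro h0
    rw [h0, zero_pow hN] at hZN
    have : (Q : ℚ_[p]) ≠ 0 := fun h => by simp [h] at hQn
    exact mul_ne_zero (pow_ne_zero _ this) (pow_ne_zero _ hp0) hZN.symm
  have hval : (s : ℤ) = Z.valuation * N := by
    have h1 := congrArg norm hZN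
    rw [norm_mul, norm_pow, norm_pow, norm_pow, hQn, one_pow, one_mul,
      Padic.norm_eq_zpow_neg_valuation hZ0, Padic.norm_p, inv_pow, ← zpow_natCast, ← zpow_natCast,
      ← zpow_mul, ← zpow_neg] at h1
    have hp1 : (1 : ℝ) < p := by exact_mod_cast (Fact.out : p.Prime).one_lt
    have h2 := zpow_right_injective₀ (by positivity) hp1.ne' h1
    linarith
  set U : ℚ_[p] := Z / (p : ℚ_[p]) ^ Z.valuation with hU
  have hUnorm : ‖U‖ = 1 := by
    rw [hU, norm_div, Padic.norm_p_zpow, ← Padic.norm_eq_zpow_neg_valuation hZ0,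
      div_self (norm_ne_zero_iff.mpr hZ0)]
  refine ⟨PadicInt.mkUnits hUnorm, ?_⟩
  refine Subtype.coe_injective ?_
  push_cast
  rw [PadicInt.mkUnits_eq, hU, div_pow, hZN, ← zpow_natCast _ N, ← zpow_mul, ← hval, zpow_natCast,
    mul_div_cancel_right₀ _ (pow_ne_zero _ hp0)]

/-- The unit group mod `p ^ (n + 1)` has order `p ^ n * (p - 1)`, so `p ^ n`-th powers in it are
killed by `p - 1`. -/
theorem prime_pow_dvd_pow_sub_one {p : ℕ} [Fact p.Prime] {Q n a : ℕ} {u : ℤ_[p]ˣ}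
    (h : (Q : ℤ_[p]) ^ a = (u : ℤ_[p]) ^ p ^ n) :
    (p : ℤ) ^ (n + 1) ∣ (Q : ℤ) ^ (a * (p - 1)) - 1 := by
  have h1 := ZMod.pow_totient (Units.map (PadicInt.toZModPow (p := p) (n + 1)).toMonoidHom u)
  rw [Nat.totient_prime_pow_succ Fact.out, pow_mul] at h1
  have h2 := congrArg Units.val h1
  have h3 := congrArg (PadicInt.toZModPow (p := p) (n + 1)) h
  rw [map_pow, map_pow, map_natCast] at h3
  have h4 : ((PadicInt.toZModPow (p := p) (n + 1) (u : ℤ_[p])) ^ p ^ n) ^ (p - 1) = 1 := by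
    simpa using h2
  rw [← h3, ← pow_mul] at h4
  have h5 : (((Q : ℤ) ^ (a * (p - 1)) - 1 : ℤ) : ZMod (p ^ (n + 1))) = 0 := by
    push_cast
    rw [h4, sub_self]
  rw [ZMod.intCast_zmod_eq_zero_iff_dvd] at h5
  exact_mod_cast h5

theorem exists_uniform_dvd {p : ℕ} [hp : Fact p.Prime] {Q : ℕ} (hQ : Q.Coprime p) (hQ1 : 1 < Q)
    {d : ℕ} (hd : 0 < d) :
    ∃ D : ℕ, D ≠ 0 ∧ ∀ (n k Y s : ℕ) (W : ℚ_[p]), Y ≠ 0 →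
      (((Q ^ k * Y ^ p ^ n * p ^ s : ℕ) : ℚ_[p]) ^ d) ^ 2 = (W ^ p ^ n) ^ 2 → p ^ n ∣ D * k := by
  have hm : 2 * (p - 1) ≠ 0 := by have := hp.out.two_le; omega
  have hone : 1 < Q ^ (2 * (p - 1)) := Nat.one_lt_pow hm hQ1
  have hpQ : (p : ℤ) ∣ (Q : ℤ) ^ (2 * (p - 1)) - 1 := by
    have h1 := Int.ModEq.pow_card_sub_one_eq_one hp.out (Nat.isCoprime_iff_coprime.mpr hQ)
    have h2 := (h1.pow 2).symm.dvd
    rwa [one_pow, ← pow_mul, mul_comm] at h2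
  have h4 : p = 2 → (4 : ℤ) ∣ (Q : ℤ) ^ (2 * (p - 1)) - 1 := by
    rintro rfl
    have hodd : Odd (Q : ℤ) := by
      exact_mod_cast Nat.coprime_two_right.mp hQ
    have := Int.sq_mod_four_eq_one_of_odd hodd
    norm_num
    omega
  -- The exponent `p - 1` makes the base `1` mod `p`; the factor `2`, already present from squaring
  -- away the sign of the norm, makes it `1` mod `4` when `p = 2`. `D` is nonzero because `Q > 1`.
  refine ⟨(Q ^ (2 * (p - 1)) - 1) * d, mul_ne_zero (by omega) hd.ne', fun n k Y s W hY h => ?_⟩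
  have h' : (Q : ℚ_[p]) ^ (2 * (d * k)) * ((Y ^ (2 * d) : ℕ) : ℚ_[p]) ^ p ^ n *
      (p : ℚ_[p]) ^ (2 * d * s) = (W ^ 2) ^ p ^ n := by
    rw [← pow_mul W, mul_comm 2 (p ^ n), pow_mul W, ← h]
    push_cast
    ring
  obtain ⟨u, hu⟩ := exists_padicInt_unit_pow hQ (pow_ne_zero _ hY)
    (pow_ne_zero _ hp.out.ne_zero) h'
  have h5 := prime_pow_dvd_pow_sub_one hu
  rw [show 2 * (d * k) * (p - 1) = 2 * (p - 1) * (d * k) by ring, pow_mul] at h5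
  have h6 := prime_pow_dvd_of_dvd_pow_sub_one hpQ h4 ((pow_dvd_pow _ n.le_succ).trans h5)
  have h7 : (((Q ^ (2 * (p - 1)) - 1) * d * k : ℕ) : ℤ) =
      ((Q : ℤ) ^ (2 * (p - 1)) - 1) * (d * k : ℕ) := by
    push_cast [Nat.cast_sub hone.le]
    ring
  rw [← h7] at h6
  exact_mod_cast h6

end Arithmetic
-- Vanishing of the integral cocycle on inertia at `l`.
section Core

open IsDedekindDomain Topology

variable {F : Type*} [Field F] {p : ℕ}

/-- Roots of unity of `p`-power order are distinct modulo primes not dividing `p`. -/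
theorem eq_one_of_sub_one_mem {R : Type*} [CommRing R] [IsDomain R] (P : Ideal R) [P.IsPrime]
    (hp : (p : R) ∉ P) {e : R} {n : ℕ} (he : e ^ p ^ n = 1) (h : e - 1 ∈ P) : e = 1 := by
  by_contra hne
  have h0 : ∑ i ∈ Finset.range (p ^ n), e ^ i = 0 := by
    have := geom_sum_mul e (p ^ n)
    rw [he, sub_self] at this
    exact (mul_eq_zero.mp this).resolve_right (sub_ne_zero.mpr hne)
  have h1 : Ideal.Quotient.mk P e = 1 := by
    rw [← map_one (Ideal.Quotient.mk P), Ideal.Quotient.eq]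
    exact h
  have h2 := congrArg (Ideal.Quotient.mk P) h0
  simp only [map_sum, map_pow, h1, one_pow, map_zero, Finset.sum_const, Finset.card_range,
    nsmul_eq_mul, mul_one] at h2
  rw [← map_natCast (Ideal.Quotient.mk P), Ideal.Quotient.eq_zero_iff_mem, Nat.cast_pow] at h2
  exact hp (Ideal.IsPrime.mem_of_pow_mem ‹_› _ h2)

theorem natCast_notMem_of_comap_eq {v : HeightOneSpectrum (𝓞 F)}
    {P : Ideal (𝓞 (Fbar F))} (hP : P.comap (algebraMap (𝓞 F) (𝓞 (Fbar F))) = v.asIdeal)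
    (hp : (p : 𝓞 F) ∉ v.asIdeal) : (p : 𝓞 (Fbar F)) ∉ P := fun h => hp (by
  rw [← hP, Ideal.mem_comap, map_natCast]
  exact h)

variable [Fact p.Prime]

theorem eq_zero_of_forall_prime_pow_dvd {t : ℤ_[p]} (h : ∀ n : ℕ, (p : ℤ_[p]) ^ n ∣ t) : t = 0 :=
  PadicInt.ext_of_toZModPow.mp fun n => by
    rw [map_zero, ← RingHom.mem_ker, PadicInt.ker_toZModPow, Ideal.mem_span_singleton]
    exact h n

theorem isIntegral_rootOfUnity {e : Fbar F} {n : ℕ} (he : e ^ p ^ n = 1) : IsIntegral ℤ e :=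
  IsIntegral.of_pow (pow_pos (Fact.out : p.Prime).pos n) (he ▸ isIntegral_one)

/-- The inertia groups at places prime to `p` fix the roots of unity of `p`-power order. -/
theorem cyc_eq_one_of_mem_inertia [CharZero F] {P : Ideal (𝓞 (Fbar F))} [P.IsPrime]
    (hp : (p : 𝓞 (Fbar F)) ∉ P) {g : GF F} (hg : g ∈ P.inertia (GF F)) : cyc F p g = 1 := by
  have key (n : ℕ) : (p : ℤ_[p]) ^ n ∣ (cyc F p g : ℤ_[p]) - 1 := by
    rw [← rootPow_eq_one_iff (F := F)]
    have h1 : g (rootPow F n (1 : ℤ_[p])) =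
        rootPow F n ((cyc F p g : ℤ_[p]) - 1) * rootPow F n (1 : ℤ_[p]) := by
      rw [map_rootPow, ← rootPow_add, mul_one, sub_add_cancel]
    let e : 𝓞 (Fbar F) := ⟨_, isIntegral_rootOfUnity
      (rootPow_pow_prime_pow (F := F) n ((cyc F p g : ℤ_[p]) - 1))⟩
    let z : 𝓞 (Fbar F) := ⟨_, isIntegral_rootOfUnity (rootPow_pow_prime_pow (F := F) n (1 : ℤ_[p]))⟩
    have hz1 : z ^ p ^ n = 1 := NumberField.RingOfIntegers.ext (rootPow_pow_prime_pow (F := F) n _)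
    have he1 : e ^ p ^ n = 1 := NumberField.RingOfIntegers.ext (rootPow_pow_prime_pow (F := F) n _)
    have hz : z ∉ P := fun h => Ideal.IsPrime.one_notMem (I := P) inferInstance
      (hz1 ▸ Ideal.pow_mem_of_mem P h _ (pow_pos (Fact.out : p.Prime).pos n))
    have h2 : g • z - z = (e - 1) * z := NumberField.RingOfIntegers.ext (by
      change g (rootPow F n (1 : ℤ_[p])) - rootPow F n (1 : ℤ_[p]) = (_ - 1) * _
      rw [h1, sub_mul, one_mul])
    have h3 : (e - 1) * z ∈ P := h2 ▸ hg z
    have h4 := eq_one_of_sub_one_mem P hp he1 ((Ideal.IsPrime.mem_or_mem ‹_› h3).resolve_right hz)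
    exact congrArg (fun y : 𝓞 (Fbar F) => (y : Fbar F)) h4
  ext1
  rw [Units.val_one, ← sub_eq_zero]
  exact eq_zero_of_forall_prime_pow_dvd key

variable [NumberField F]

/-- If `D * v(x) = p ^ n * m`, then `α ^ D / ϖ ^ m` is a `p ^ n`-th root of a `v`-unit. Inertia
multiplies it by `e ^ D`, which is therefore `1` mod `P`, hence equal to `1` as `P` does not contain
`p`. -/
theorem pow_eq_one_of_dvd_multiplicity {v : HeightOneSpectrum (𝓞 F)}
    {P : Ideal (𝓞 (Fbar F))} [P.IsPrime]
    (hP : P.comap (algebraMap (𝓞 F) (𝓞 (Fbar F))) = v.asIdeal) (hp : (p : 𝓞 F) ∉ v.asIdeal)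
    {n D : ℕ} {α e : Fbar F} {x : 𝓞 F} (hx : x ≠ 0) (hα : α ^ p ^ n = algebraMap F (Fbar F) x)
    (hdvd : p ^ n ∣ D * multiplicity v.asIdeal (Ideal.span {x}))
    {g : GF F} (hg : g ∈ P.inertia (GF F)) (hgα : g α = e * α) (he : e ^ p ^ n = 1) :
    e ^ D = 1 := by
  obtain ⟨m, hm⟩ := hdvd
  obtain ⟨ϖ, hϖ⟩ := v.intValuation_exists_uniformizer
  have hϖ0 : ϖ ≠ 0 := by
    rintro rfl
    rw [map_zero] at hϖ
    exact WithZero.exp_ne_zero hϖ.symm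
  have hϖF : (ϖ : F) ≠ 0 := by simpa using hϖ0
  have hval : v.valuation F ((x : F) ^ D / (ϖ : F) ^ (p ^ n * m)) = 1 := by
    have h1 : v.valuation F (x : F) = _ := v.valuation_of_algebraMap x
    have h2 : v.valuation F (ϖ : F) = _ := v.valuation_of_algebraMap ϖ
    rw [map_div₀, map_pow, map_pow, h1, h2, hϖ, v.intValuation_eq_exp_neg_multiplicity hx, ← hm,
      ← WithZero.exp_nsmul, ← WithZero.exp_nsmul]
    simp
  obtain ⟨r, ⟨s, hs⟩, hrs⟩ := v.exists_primeCompl_mul_eq_of_integer _ hval.le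
  have hr : r ∉ v.asIdeal := by
    have h1 := congrArg (v.valuation F) hrs
    rw [map_mul, hval, one_mul, v.valuation_of_algebraMap, v.valuation_of_algebraMap,
      (v.intValuation_eq_one_iff_mem_primeCompl s).mpr hs] at h1
    exact (v.intValuation_eq_one_iff_mem_primeCompl r).mp h1.symm
  have hN : p ^ n ≠ 0 := pow_ne_zero _ (Fact.out : p.Prime).ne_zero
  let i := algebraMap F (Fbar F)
  -- The factor `s`, prime to `v`, clears denominators: `z₀ ^ p ^ n = r * s ^ (p ^ n - 1)` is
  -- integral and outside `v`.
  let z₀ : Fbar F := α ^ D * i ((s : F) / (ϖ : F) ^ m)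
  have hz₀ : z₀ ^ p ^ n = i ((r * s ^ (p ^ n - 1) : 𝓞 F) : F) := by
    have hrs' : (x : F) ^ D / (ϖ : F) ^ (p ^ n * m) * (s : F) = (r : F) := hrs
    have h1 : (x : F) ^ D * ((s : F) / (ϖ : F) ^ m) ^ p ^ n =
        ((r * s ^ (p ^ n - 1) : 𝓞 F) : F) := by
      have h2 : ((r * s ^ (p ^ n - 1) : 𝓞 F) : F) = (r : F) * (s : F) ^ (p ^ n - 1) := by simp
      rw [h2, ← hrs', mul_assoc, ← pow_succ', Nat.sub_add_cancel
        (Nat.pos_of_ne_zero hN), div_pow, ← pow_mul, mul_comm m]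
      ring
    rw [← h1, map_mul, map_pow, map_pow, ← hα]
    ring
  have hzint : IsIntegral ℤ z₀ := by
    refine IsIntegral.of_pow (Nat.pos_of_ne_zero hN) ?_
    rw [hz₀]
    exact (NumberField.RingOfIntegers.isIntegral_coe _).map (IsScalarTower.toAlgHom ℤ F (Fbar F))
  let z : 𝓞 (Fbar F) := ⟨z₀, hzint⟩
  have hzP : z ∉ P := by
    intro hz
    have h1 : z ^ p ^ n = algebraMap (𝓞 F) (𝓞 (Fbar F)) (r * s ^ (p ^ n - 1)) :=
      NumberField.RingOfIntegers.ext hz₀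
    have h2 : r * s ^ (p ^ n - 1) ∈ v.asIdeal := by
      rw [← hP, Ideal.mem_comap, ← h1]
      exact Ideal.pow_mem_of_mem P hz _ (Nat.pos_of_ne_zero hN)
    have := v.isPrime
    exact (Ideal.IsPrime.mem_or_mem ‹_› h2).elim hr
      fun h => hs (Ideal.IsPrime.mem_of_pow_mem ‹_› _ h)
  have heD : (e ^ D) ^ p ^ n = 1 := by rw [← pow_mul, mul_comm, pow_mul, he, one_pow]
  let e' : 𝓞 (Fbar F) := ⟨e ^ D, isIntegral_rootOfUnity heD⟩
  have he' : e' ^ p ^ n = 1 := NumberField.RingOfIntegers.ext heD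
  have hgz : g • z - z = (e' - 1) * z := NumberField.RingOfIntegers.ext (by
    change g z₀ - z₀ = (e ^ D - 1) * z₀
    rw [map_mul, map_pow, hgα, AlgEquiv.commutes]
    ring)
  have h3 : (e' - 1) * z ∈ P := hgz ▸ hg z
  have h4 := eq_one_of_sub_one_mem P (natCast_notMem_of_comap_eq hP hp) he'
    ((Ideal.IsPrime.mem_or_mem ‹_› h3).resolve_right hzP)
  exact congrArg (fun y : 𝓞 (Fbar F) => (y : Fbar F)) h4

theorem cocycle_eq_zero_of_mem_inertia {l : HeightOneSpectrum (𝓞 F)} (hl : (p : 𝓞 F) ∉ l.asIdeal)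
    {b : GF F → ℤ_[p]} (hb : ∀ g h, b (g * h) = b g + cyc F p g * b h)
    (hcont : ∀ n : ℕ, {g | (p : ℤ_[p]) ^ n ∣ b g} ∈ 𝓝 (1 : GF F))
    (hur : ∀ v : HeightOneSpectrum (𝓞 F), v ≠ l → (p : 𝓞 F) ∉ v.asIdeal →
      ∀ P : Ideal (𝓞 (Fbar F)), P.IsPrime →
        P.comap (algebraMap (𝓞 F) (𝓞 (Fbar F))) = v.asIdeal → ∀ g ∈ P.inertia (GF F), b g = 0)
    (hsplit : ∀ j : F →ₐ[ℚ] PadicAlgCl p, ∃ σ : Fbar F →+* PadicAlgCl p,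
      (∀ x : F, σ (algebraMap F (Fbar F) x) = j x) ∧ ∃ t : ℤ_[p],
        ∀ g ∈ MulAction.stabilizer (GF F) (placeIdeal σ), b g = (cyc F p g - 1) * t)
    {P : Ideal (𝓞 (Fbar F))} [P.IsPrime]
    (hP : P.comap (algebraMap (𝓞 F) (𝓞 (Fbar F))) = l.asIdeal) {g : GF F}
    (hg : g ∈ P.inertia (GF F)) : b g = 0 := by
  obtain ⟨d, hd, hnorm⟩ := exists_finrank_norm_pow_eq_pow p F
  have hQ1 : 1 < Ideal.absNorm l.asIdeal := by
    have h0 : Ideal.absNorm l.asIdeal ≠ 0 := Ideal.absNorm_eq_zero_iff.not.mpr l.ne_bot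
    have h1 : Ideal.absNorm l.asIdeal ≠ 1 := Ideal.absNorm_eq_one_iff.not.mpr l.isPrime.ne_top
    omega
  have hQ : (Ideal.absNorm l.asIdeal).Coprime p := by
    rw [Nat.coprime_comm, (Fact.out : p.Prime).coprime_iff_not_dvd]
    intro hdvd
    have := l.isMaximal
    obtain ⟨q, f, -, hql, hq, hf⟩ := Ideal.exists_prime_and_absNorm_eq_pow l.asIdeal
    rw [hf] at hdvd
    have := (Nat.prime_dvd_prime_iff_eq Fact.out hq).mp ((Fact.out : p.Prime).dvd_of_dvd_pow hdvd)
    exact hl (this ▸ hql)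
  obtain ⟨D, hD, hDk⟩ := exists_uniform_dvd hQ hQ1 hd
  have key (n : ℕ) : (p : ℤ_[p]) ^ n ∣ D * b g := by
    obtain ⟨α, x, hx, hα, hgα⟩ := exists_integral_kummer_generator hb (hcont n)
    obtain ⟨W, hW⟩ := hnorm (p ^ n) x fun j => by
      obtain ⟨σ, hσ, t, ht⟩ := hsplit j
      obtain ⟨β, hβ, hβτ⟩ := exists_root_of_local_splitting ht hα hgα
      simp only [hσ] at hβ hβτ
      exact ⟨β, hβ, hβτ⟩
    obtain ⟨Y, s, hY, hYs⟩ := exists_absNorm_eq_mul_pow_mul_pow (p := p) l (N := p ^ n)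
      (I := Ideal.span {x}) (by simpa using hx) fun v hv hpv => by
        have := v.isMaximal
        obtain ⟨P', hP', hP'v⟩ := Ideal.exists_maximal_ideal_liesOver_of_isIntegral
          (S := 𝓞 (Fbar F)) v.asIdeal
        have hP'v' : P'.comap (algebraMap (𝓞 F) (𝓞 (Fbar F))) = v.asIdeal := hP'v.over.symm
        refine dvd_multiplicity_of_inertia_fixed v P' hP'v' hx hα
          (pow_ne_zero _ (Fact.out : p.Prime).ne_zero) fun g' hg' => ?_
        rw [hgα, hur v hv hpv P' hP'.isPrime hP'v' g' hg', rootPow_zero, one_mul]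
    -- The ideal norm is the absolute value of the element norm; squaring removes the sign.
    have hdvd := hDk n (multiplicity l.asIdeal (Ideal.span {x})) Y s W hY (by
      rw [← hYs, ← hW, Ideal.absNorm_span_singleton, ← Algebra.coe_norm_int, Rat.cast_intCast,
        ← pow_mul, ← pow_mul, mul_comm d 2, pow_mul, pow_mul, ← Int.cast_natCast, ← Int.cast_pow,
        Int.natAbs_sq, Int.cast_pow])
    rw [← rootPow_eq_one_iff (F := F), ← rootPow_pow]
    exact pow_eq_one_of_dvd_multiplicity hP hl hx hα hdvd hg (hgα g) (rootPow_pow_prime_pow n _)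
  have h0 : (D : ℤ_[p]) * b g = 0 := eq_zero_of_forall_prime_pow_dvd key
  exact (mul_eq_zero.mp h0).resolve_left (Nat.cast_ne_zero.mpr hD)

end Core
-- From the extension to integral cocycles.
namespace TateExt

open IsDedekindDomain Topology

variable {F : Type*} [Field F] {p : ℕ} [Fact p.Prime]
  {K : Type*} [NormedField K] [NormedAlgebra ℚ_[p] K]
  {V : Type*} [AddCommGroup V] [Module K V] [TopologicalSpace V]

/-- A `K`-linear splitting of the extension `V`. -/
structure Frame (E : TateExt F p K V) where
  /-- the retraction onto `K` -/
  r : V →ₗ[K] K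
  /-- the lift of `1 ∈ K(-1)` -/
  e : V
  r_incl : ∀ a, r (E.incl a) = a
  r_e : r e = 0
  proj_e : E.proj e = 1

theorem exists_frame (E : TateExt F p K V) : Nonempty E.Frame := by
  obtain ⟨r, hr⟩ := E.incl.exists_leftInverse_of_injective
    (LinearMap.ker_eq_bot.mpr E.incl_injective)
  have hr' (a : K) : r (E.incl a) = a := LinearMap.congr_fun hr a
  obtain ⟨e, he⟩ := E.proj_surjective 1
  exact ⟨⟨r, e - E.incl (r e), hr', by rw [map_sub, hr', sub_self],
    by rw [map_sub, he, E.exact.apply_apply_eq_zero, sub_zero]⟩⟩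

namespace Frame

variable {E : TateExt F p K V} (B : E.Frame)

theorem eq_add (x : V) : x = E.incl (B.r x) + E.proj x • B.e := by
  obtain ⟨a, ha⟩ := (E.exact (x - E.proj x • B.e)).mp (by simp [B.proj_e])
  have h1 := congrArg B.r ha
  rw [B.r_incl, map_sub, map_smul, B.r_e, smul_zero, sub_zero] at h1
  rw [← h1, ha, sub_add_cancel]

/-- The cocycle of the extension in the given frame. -/
def c (g : GF F) : K := B.r (E.ρ g B.e)

theorem rho_e (g : GF F) : E.ρ g B.e = E.incl (B.c g) + cycInv F p K g • B.e := by
  have h := B.eq_add (E.ρ g B.e)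
  rwa [E.proj_equivariant, B.proj_e, mul_one] at h

theorem c_mul (g h : GF F) : B.c (g * h) = B.c h + cycInv F p K h * B.c g := by
  rw [c, map_mul, Module.End.mul_apply, rho_e, map_add, E.incl_equivariant, map_smul, map_add,
    B.r_incl, map_smul, smul_eq_mul]
  rfl

theorem c_one : B.c 1 = 0 := by rw [c, map_one, Module.End.one_apply, B.r_e]

/-- Linear sections of `proj` are `1 ↦ incl t + e`; equivariance says that `c` is the coboundary of
`t`. -/
theorem splitsOver_iff (H : Subgroup (GF F)) :
    E.SplitsOver H ↔ ∃ t : K, ∀ g ∈ H, B.c g = (cycInv F p K g - 1) * t := by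
  constructor
  · rintro ⟨s, hs, hsH⟩
    refine ⟨B.r (s 1), fun g hg => ?_⟩
    have h1 := congrArg B.r (hsH g hg 1)
    have h2 := B.eq_add (s 1)
    rw [hs, one_smul] at h2
    have h3 : s (cycInv F p K g * 1) = cycInv F p K g • s 1 := by rw [← map_smul, smul_eq_mul]
    rw [h3, map_smul, smul_eq_mul] at h1
    conv_lhs at h1 => rw [h2, map_add, E.incl_equivariant, map_add, B.r_incl]
    rw [c]
    linear_combination h1
  · rintro ⟨t, ht⟩
    refine ⟨LinearMap.toSpanSingleton K V (E.incl t + B.e), fun a => ?_, fun g hg a => ?_⟩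
    · simp [E.exact.apply_apply_eq_zero, B.proj_e]
    · have hc : E.incl ((cycInv F p K g - 1) * t) =
          cycInv F p K g • E.incl t - E.incl t := by
        rw [sub_mul, one_mul, map_sub, ← smul_eq_mul, map_smul]
      simp only [LinearMap.toSpanSingleton_apply, map_smul, map_add, E.incl_equivariant,
        rho_e, ht g hg, hc]
      module

/-- The `ℚ_p(1)`-valued cocycle obtained from a functional on `K`. -/
def padicCocycle (φ : K →ₗ[ℚ_[p]] ℚ_[p]) (g : GF F) : ℚ_[p] :=
  ((cyc F p g : ℤ_[p]) : ℚ_[p]) * φ (B.c g)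

theorem cyc_mul_cycInv_smul (φ : K →ₗ[ℚ_[p]] ℚ_[p]) (g : GF F) (a : K) :
    ((cyc F p g : ℤ_[p]) : ℚ_[p]) * φ (cycInv F p K g * a) = φ a := by
  rw [cycInv, ← Algebra.smul_def, map_smul, smul_eq_mul, ← mul_assoc, ← PadicInt.coe_mul,
    Units.mul_inv, PadicInt.coe_one, one_mul]

/-- The factor `χ` turns the relation for `c`, twisted by `χ⁻¹` on the other side, into the left
cocycle relation of Kummer theory. -/
theorem padicCocycle_mul (φ : K →ₗ[ℚ_[p]] ℚ_[p]) (g h : GF F) :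
    B.padicCocycle φ (g * h) =
      B.padicCocycle φ g + ((cyc F p g : ℤ_[p]) : ℚ_[p]) * B.padicCocycle φ h := by
  rw [padicCocycle, c_mul, map_add, map_mul, Units.val_mul, PadicInt.coe_mul, mul_add, mul_assoc,
    mul_assoc, cyc_mul_cycInv_smul, padicCocycle, padicCocycle, add_comm]

theorem norm_padicCocycle (φ : K →ₗ[ℚ_[p]] ℚ_[p]) (g : GF F) :
    ‖B.padicCocycle φ g‖ = ‖φ (B.c g)‖ := by
  rw [padicCocycle, norm_mul, ← PadicInt.norm_def, PadicInt.norm_units, one_mul]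

theorem continuous_functional_c [FiniteDimensional ℚ_[p] K] [IsModuleTopology K V]
    (φ : K →ₗ[ℚ_[p]] ℚ_[p]) : Continuous fun g => φ (B.c g) := by
  have h1 : Continuous B.r := IsModuleTopology.continuous_of_linearMap B.r
  have h2 : Continuous φ := φ.continuous_of_finiteDimensional
  have h3 : Continuous fun g : GF F => E.ρ g B.e :=
    E.continuous_action.comp (continuous_id.prodMk continuous_const)
  exact h2.comp (h1.comp h3)

theorem exists_padicCocycle_eq_of_splitsOver {H : Subgroup (GF F)} (h : E.SplitsOver H)
    (φ : K →ₗ[ℚ_[p]] ℚ_[p]) :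
    ∃ t : ℚ_[p], ∀ g ∈ H, B.padicCocycle φ g = (((cyc F p g : ℤ_[p]) : ℚ_[p]) - 1) * t := by
  obtain ⟨t, ht⟩ := (B.splitsOver_iff H).mp h
  refine ⟨-φ t, fun g hg => ?_⟩
  rw [padicCocycle, ht g hg, sub_mul, one_mul, map_sub, mul_sub, cyc_mul_cycInv_smul]
  ring

end Frame

/-- Maschke averaging: summing the cocycle relation over `H` exhibits `c` as a coboundary. -/
theorem splitsOver_of_finite [CharZero K] (E : TateExt F p K V) (H : Subgroup (GF F)) [Finite H] :
    E.SplitsOver H := by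
  have := Fintype.ofFinite H
  obtain ⟨B⟩ := E.exists_frame
  rw [B.splitsOver_iff]
  have hn : (Fintype.card H : K) ≠ 0 := Nat.cast_ne_zero.mpr Fintype.card_ne_zero
  refine ⟨-(∑ g : H, B.c g) / Fintype.card H, fun h hh => ?_⟩
  have h1 : ∑ g : H, B.c g = ∑ g : H, B.c (g * h) :=
    (Fintype.sum_equiv (Equiv.mulRight (⟨h, hh⟩ : H)) _ _ fun g => rfl).symm
  simp only [B.c_mul, Finset.sum_add_distrib, Finset.sum_const, Finset.card_univ, nsmul_eq_mul,
    ← Finset.mul_sum] at h1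
  field_simp
  linear_combination -h1

theorem splitsOver_placeIdeal [NumberField F] {E : TateExt F p K V} {l : HeightOneSpectrum (𝓞 F)}
    (hl : (p : 𝓞 F) ∉ l.asIdeal) (hE : E.IsUnramifiedOutside l) (σ : Fbar F →+* PadicAlgCl p) :
    E.SplitsOver (MulAction.stabilizer (GF F) (placeIdeal σ)) := by
  have hp : (p : 𝓞 F) ∈ (placeIdeal σ).comap (algebraMap (𝓞 F) (𝓞 (Fbar F))) := by
    rw [Ideal.mem_comap, map_natCast]
    exact natCast_mem_placeIdeal σ
  let v : HeightOneSpectrum (𝓞 F) := ⟨(placeIdeal σ).comap (algebraMap (𝓞 F) (𝓞 (Fbar F))),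
    inferInstance, fun h => Nat.cast_ne_zero.mpr (Fact.out : p.Prime).ne_zero
      ((Submodule.mem_bot _).mp (h ▸ hp))⟩
  have hv : v ≠ l := fun h => hl (h ▸ hp)
  exact (hE v hv (placeIdeal σ) inferInstance rfl).2 hp

theorem exists_pow_mul_norm_le_one {ι : Type*} [Finite ι] (t : ι → ℚ_[p]) (C : ℝ) :
    ∃ m : ℕ, (∀ i, ‖(p : ℚ_[p]) ^ m * t i‖ ≤ 1) ∧ ∀ x : ℚ_[p], ‖x‖ ≤ C →
      ‖(p : ℚ_[p]) ^ m * x‖ ≤ 1 := by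
  obtain ⟨A, hA⟩ := (Set.finite_range fun i => ‖t i‖).bddAbove
  have hp1 : (1 : ℝ) < p := by exact_mod_cast (Fact.out : p.Prime).one_lt
  obtain ⟨m, hm⟩ := pow_unbounded_of_one_lt (max A C) hp1
  have key (x : ℚ_[p]) (hx : ‖x‖ ≤ max A C) : ‖(p : ℚ_[p]) ^ m * x‖ ≤ 1 := by
    rw [norm_mul, norm_pow, Padic.norm_p, inv_pow, inv_mul_le_iff₀ (by positivity), mul_one]
    exact hx.trans hm.le
  exact ⟨m, fun i => key _ ((hA ⟨i, rfl⟩).trans (le_max_left _ _)),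
    fun x hx => key x (hx.trans (le_max_right _ _))⟩

theorem functional_c_eq_zero [NumberField F] [FiniteDimensional ℚ_[p] K] [IsModuleTopology K V]
    {E : TateExt F p K V} {l : HeightOneSpectrum (𝓞 F)}
    (hl : (p : 𝓞 F) ∉ l.asIdeal) (hE : E.IsUnramifiedOutside l) (B : E.Frame)
    (φ : K →ₗ[ℚ_[p]] ℚ_[p]) {P : Ideal (𝓞 (Fbar F))} [P.IsPrime]
    (hP : P.comap (algebraMap (𝓞 F) (𝓞 (Fbar F))) = l.asIdeal) {g : GF F}
    (hg : g ∈ P.inertia (GF F)) : φ (B.c g) = 0 := by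
  choose σ hσ using fun j : F →ₐ[ℚ] PadicAlgCl p =>
    exists_extend_embedding (F := F) (j : F →+* PadicAlgCl p)
  choose t ht using fun j => B.exists_padicCocycle_eq_of_splitsOver
    (splitsOver_placeIdeal hl hE (σ j)) φ
  have hcφ := B.continuous_functional_c φ
  -- Compactness of `G_F` bounds the cocycle, so one power of `p` makes it and the finitely many
  -- local splitting constants integral.
  obtain ⟨C, hC⟩ := (isCompact_range hcφ).isBounded.exists_norm_le
  obtain ⟨m, hmt, hmC⟩ := exists_pow_mul_norm_le_one t C
  let b : GF F → ℤ_[p] := fun g => ⟨(p : ℚ_[p]) ^ m * B.padicCocycle φ g,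
    hmC _ (B.norm_padicCocycle φ g ▸ hC _ ⟨g, rfl⟩)⟩
  have hbc (g : GF F) : (b g : ℚ_[p]) = (p : ℚ_[p]) ^ m * B.padicCocycle φ g := rfl
  have hp0 : (p : ℚ_[p]) ^ m ≠ 0 :=
    pow_ne_zero _ (Nat.cast_ne_zero.mpr (Fact.out : p.Prime).ne_zero)
  have hb0 (g : GF F) : b g = 0 ↔ φ (B.c g) = 0 := by
    rw [← norm_eq_zero (a := φ (B.c g)), ← B.norm_padicCocycle, norm_eq_zero, ← PadicInt.coe_eq_zero]
    exact mul_eq_zero_iff_left hp0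
  rw [← hb0]
  refine cocycle_eq_zero_of_mem_inertia hl (b := b) (fun g h => ?_) (fun n => ?_) ?_ ?_ hP hg
  · refine PadicInt.ext ?_
    rw [PadicInt.coe_add, PadicInt.coe_mul, hbc, hbc, hbc, B.padicCocycle_mul]
    ring
  · have h1 : {g : GF F | ‖(p : ℚ_[p]) ^ m * φ (B.c g)‖ < (p : ℝ) ^ (-n : ℤ)} ∈ 𝓝 (1 : GF F) := by
      have hcont : Continuous fun g => ‖(p : ℚ_[p]) ^ m * φ (B.c g)‖ :=
        (continuous_const.mul hcφ).norm
      refine (isOpen_lt hcont continuous_const).mem_nhds ?_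
      have : (0 : ℝ) < p := by exact_mod_cast (Fact.out : p.Prime).pos
      simpa [B.c_one] using by positivity
    filter_upwards [h1] with g hg
    rw [← Ideal.mem_span_singleton, ← PadicInt.norm_le_pow_iff_mem_span_pow]
    refine le_of_eq_of_le ?_ (le_of_lt hg)
    change ‖(p : ℚ_[p]) ^ m * B.padicCocycle φ g‖ = _
    rw [norm_mul, norm_mul, B.norm_padicCocycle]
  · intro v hv hpv P' hP' hP'v g' hg'
    rw [hb0, Frame.c, ((hE v hv P' hP' hP'v).1 hpv g' hg'), B.r_e, map_zero]
  · intro j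
    obtain ⟨T, hT⟩ : ∃ T : ℤ_[p], (T : ℚ_[p]) = (p : ℚ_[p]) ^ m * t j := ⟨⟨_, hmt j⟩, rfl⟩
    refine ⟨σ j, hσ j, T, fun g hg => PadicInt.ext ?_⟩
    rw [hbc, PadicInt.coe_mul, PadicInt.coe_sub, PadicInt.coe_one, hT, ht j g hg]
    ring

end TateExt
end GaloisExt

end

/-! ### Assembly over all places. -/

theorem mainTheorem10
    (F : Type*) [Field F] [NumberField F] [NumberField.IsTotallyReal F]
    (p : ℕ) [Fact p.Prime]
    (l : IsDedekindDomain.HeightOneSpectrum (𝓞 F)) (hl : (p : 𝓞 F) ∉ l.asIdeal)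
    (K : Type*) [NormedField K] [NormedAlgebra ℚ_[p] K] [FiniteDimensional ℚ_[p] K]
    (V : Type*) [AddCommGroup V] [Module K V] [TopologicalSpace V] [IsModuleTopology K V]
    (E : GaloisExt.TateExt F p K V)
    (hE : E.IsUnramifiedOutside l) :
    E.IsUnramifiedEverywhere := by
  obtain ⟨B⟩ := E.exists_frame
  refine ⟨fun v P hP hPv => ?_, fun w => ?_⟩
  · rcases eq_or_ne v l with rfl | hv
    · refine ⟨fun _ g hg x => ?_, fun h => absurd h hl⟩
      -- Functionals over `ℚ_p` separate the points of `K`, so the `ℚ_p`-valued case suffices.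
      have hc : B.c g = 0 := (Module.forall_dual_apply_eq_zero_iff ℚ_[p] _).mp fun φ =>
        GaloisExt.TateExt.functional_c_eq_zero hl hE B φ hPv hg
      have hχ : GaloisExt.cyc F p g = 1 := GaloisExt.cyc_eq_one_of_mem_inertia
        (GaloisExt.natCast_notMem_of_comap_eq hPv hl) hg
      have hχ' : GaloisExt.cycInv F p K g = 1 := by simp [GaloisExt.cycInv, hχ]
      rw [B.eq_add x, map_add, E.incl_equivariant, map_smul, B.rho_e, hc, hχ', map_zero, zero_add,
        one_smul]
    · exact hE v hv P hP hPv
  · have : CharZero K := charZero_of_injective_algebraMap (algebraMap ℚ_[p] K).injective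
    have : Finite (MulAction.stabilizer (GaloisExt.GF F) w) := by
      refine Nat.finite_of_card_ne_zero ?_
      rcases NumberField.InfinitePlace.nat_card_stabilizer_eq_one_or_two F w with h | h <;>
        rw [h] <;> norm_num
    exact E.splitsOver_of_finite _
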